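/- Let $\Sigma$ be a finite terminal alphabet and $\Gamma$ a finite attribute alphabet. A $\Gamma$-tuple for $w \in \Sigma^*$ is a function $t : \Gamma \to \mathcal{P}(\{1, \ldots, |w|\})$, and a $(\Sigma,\Gamma)$-extractor is a function $E$ that maps every $w \in \Sigma^*$ to a (possibly empty) set $E(w)$ of $\Gamma$-tuples for $w$. For $X \subseteq \Gamma$ and $b \in \Sigma$ let $X_b$ be the marker with marker set $X$ and sign $b$, and let $\Delta_{\Sigma,\Gamma}$ be the finite alphabet of all markers. A marker string $W \in \Delta_{\Sigma,\Gamma}^*$ has a sign $\mathsf{sign}(W) \in \Sigma^*$ (the string of the signs of its letters) and represents the tuple $[\![W]\!]$ for $\mathsf{sign}(W)$ with $[\![W]\!](x) = \{i \mid x \text{ is in the marker set of } W[i]\}$. A language $L \subseteq \Delta_{\Sigma,\Gamma}^*$ represents the extractor $[\![L]\!](w) = \{[\![W]\!] \mid W \in L,\ \mathsf{sign}(W) = w\}$. * Let $\mathcal{E}^{\Sigma,\Gamma}_{\mathsf{REG}}$ be the set of the extractors $[\![L]\!]$ with $L \subseteq \Delta_{\Sigma,\Gamma}^*$ regular. * View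 $w \in \Sigma^*$ as the structure $(\{1,\ldots,|w|\}, <, (P_a)_{a\in\Sigma})$ with $P_a = \{i \mid w[i] = a\}$. Let $\mathcal{E}^{\Sigma,\Gamma}_{\mathsf{MSO}}$ be the set of the extractors $[\![\varphi]\!]$, where $\varphi$ is a formula of monadic second-order logic over the signature $(<, (P_a)_{a \in \Sigma})$ whose free variables are set variables $X_\gamma$, one for each $\gamma \in \Gamma$, and $[\![\varphi]\!](w)$ is the set of all $\Gamma$-tuples $t$ for $w$ such that $\varphi$ holds in $w$ when every $X_\gamma$ is interpreted as $t(\gamma)$. * Let $\mathbb{A}_{\Sigma,\Gamma}$ be the set of atomic extractors $E_{X,b}$ for $X \subseteq \Gamma$, $b \in \Sigma$, where $E_{X,b}(w) = \emptyset$ for $w \neq b$ and $E_{X,b}(b) = \{t\}$ with $t(x) = \{1\}$ for $x \in X$ and $t(y) = \emptyset$ for $y \in \Gamma\setminus X$. For extractors let $(E_1 \cup E_2)(w) = E_1(w) \cup E_2(w)$ and $(E_1 \cdot E_2)(w) = \bigcup_{w = w_1 w_2} \{t_1 \cdot t_2 \mid t_1 \in E_1(w_1), t_2 \in E_2(w_2)\}$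 with $(t_1 \cdot t_2)(x) = t_1(x) \cup \{i + |w_1| \mid i \in t_2(x)\}$. Let $E^* = \bigcup_{k \ge 0} E^k$, where $E^0$ maps the empty string to the set containing only the tuple with all entries empty and every other string to $\emptyset$, and $E^{k+1} = E^k \cdot E$. Let $(\mathbb{A}_{\Sigma,\Gamma})^{\{\cup,\cdot,*\}}$ be the set of extractors described by expressions built with $\cup$, $\cdot$ and ${}^*$ from atoms in $\mathbb{A}_{\Sigma,\Gamma}$ and, as in regular expressions, the constant $\emptyset$ (the extractor that maps every string to the empty table). Then $$\mathcal{E}^{\Sigma,\Gamma}_{\mathsf{REG}} = \mathcal{E}^{\Sigma,\Gamma}_{\mathsf{MSO}} = (\mathbb{A}_{\Sigma,\Gamma})^{\{\cup,\cdot,*\}}.$$ -/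

import Mathlib

universe u v

namespace InfoExtraction

/-- The set `{1, 2, …, |w|}` of positions of a string `w` (positions are counted from `1`). -/
def positions {A : Type u} (w : List A) : Set ℕ := Set.Icc 1 w.length

/-- `HasLetter w i a`: `i` is a position of `w` and the `i`-th letter of `w` is `a`. -/
def HasLetter {A : Type u} (w : List A) (i : ℕ) (a : A) : Prop :=
  1 ≤ i ∧ w[i - 1]? = some a

/-! ### Tuples, tables, extractors -/

/-- `IsTupleFor w t`: the function `t` is a `Γ`-tuple for `w`, i.e. `t : Γ → 𝒫({1, …, |w|})`. -/
def IsTupleFor {α : Type u} {Γ : Type v} (w : List α) (t : Γ → Set ℕ) : Prop :=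
  ∀ x, t x ⊆ positions w

/-- An `(α, Γ)`-extractor maps every string `w` over the terminal alphabet `α` to a `Γ`-table
for `w`, i.e. to a set of `Γ`-tuples for `w`. -/
@[ext]
structure Extractor (α : Type u) (Γ : Type v) where
  table : List α → Set (Γ → Set ℕ)
  isTuple : ∀ w, ∀ t ∈ table w, IsTupleFor w t

/-- The concatenation `t₁ · t₂` of `Γ`-tuples for `w₁` and `w₂`, where `n = |w₁|`. -/
def tupleConcat {Γ : Type v} (n : ℕ) (t₁ t₂ : Γ → Set ℕ) : Γ → Set ℕ :=
  fun x => t₁ x ∪ (fun i => i + n) '' t₂ x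

theorem isTupleFor_tupleConcat {α : Type u} {Γ : Type v} {w₁ w₂ : List α}
    {t₁ t₂ : Γ → Set ℕ} (h₁ : IsTupleFor w₁ t₁) (h₂ : IsTupleFor w₂ t₂) :
    IsTupleFor (w₁ ++ w₂) (tupleConcat w₁.length t₁ t₂) := by
  rintro x i (hi | ⟨j, hj, rfl⟩)
  · have := h₁ x hi
    simp only [positions, Set.mem_Icc, List.length_append] at this ⊢
    omega
  · have := h₂ x hj
    simp only [positions, Set.mem_Icc, List.length_append] at this ⊢
    omega

namespace Extractor

variable {α : Type u} {Γ : Type v}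

/-- The extractor whose table is empty on every string (the union of no extractors). -/
def nowhere (α : Type u) (Γ : Type v) : Extractor α Γ where
  table _ := ∅
  isTuple := by simp

/-- The union `(E₁ ∪ E₂)(w) = E₁(w) ∪ E₂(w)`. -/
def union (E₁ E₂ : Extractor α Γ) : Extractor α Γ where
  table w := E₁.table w ∪ E₂.table w
  isTuple := by
    rintro w t (h | h)
    · exact E₁.isTuple w t h
    · exact E₂.isTuple w t h

/-- The concatenation
`(E₁ · E₂)(w) = ⋃_{w = w₁ w₂} {t₁ · t₂ | t₁ ∈ E₁(w₁), t₂ ∈ E₂(w₂)}`. -/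
def concat (E₁ E₂ : Extractor α Γ) : Extractor α Γ where
  table w := {t | ∃ w₁ w₂, w = w₁ ++ w₂ ∧ ∃ t₁ ∈ E₁.table w₁, ∃ t₂ ∈ E₂.table w₂,
    t = tupleConcat w₁.length t₁ t₂}
  isTuple := by
    rintro w t ⟨w₁, w₂, rfl, t₁, h₁, t₂, h₂, rfl⟩
    exact isTupleFor_tupleConcat (E₁.isTuple _ _ h₁) (E₂.isTuple _ _ h₂)

/-- The extractor that maps the empty string to the table containing only the `Γ`-tuple all of
whose entries are empty, and every other string to the empty table; the neutral element of
concatenation. -/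
def unit (α : Type u) (Γ : Type v) : Extractor α Γ where
  table w := {t | w = [] ∧ t = fun _ => ∅}
  isTuple := by
    rintro w t ⟨-, rfl⟩ x
    exact Set.empty_subset _

/-- The powers `E⁰ = unit` and `Eᵏ⁺¹ = Eᵏ · E`. -/
def power (E : Extractor α Γ) : ℕ → Extractor α Γ
  | 0 => unit α Γ
  | k + 1 => concat (power E k) E

/-- The Kleene star `E* = ⋃_{k ≥ 0} Eᵏ`. -/
def star (E : Extractor α Γ) : Extractor α Γ where
  table w := ⋃ k, (E.power k).table w
  isTuple := by
    intro w t h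
    obtain ⟨k, hk⟩ := Set.mem_iUnion.1 h
    exact (E.power k).isTuple w t hk

end Extractor

/-! ### Marker strings, marker languages, regular extractors -/

/-- The alphabet of markers `X_b` with marker set `X ⊆ Γ` and sign `b ∈ α`; the pair `(X, b)`
stands for `X_b`. -/
abbrev Marker (α : Type u) (Γ : Type v) : Type (max v u) := Set Γ × α

/-- The sign of a marker string. -/
def sign {α : Type u} {Γ : Type v} (W : List (Marker α Γ)) : List α := W.map Prod.snd

/-- The tuple `⟦W⟧` of a marker string: `⟦W⟧(x) = {i | x ∈ W[i]}`. -/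
def markerTuple {α : Type u} {Γ : Type v} (W : List (Marker α Γ)) : Γ → Set ℕ :=
  fun x => {i | ∃ m : Marker α Γ, HasLetter W i m ∧ x ∈ m.1}

theorem isTupleFor_markerTuple {α : Type u} {Γ : Type v} (W : List (Marker α Γ)) :
    IsTupleFor (sign W) (markerTuple W) := by
  rintro x i ⟨m, ⟨h1, hm⟩, -⟩
  obtain ⟨hlt, -⟩ := List.getElem?_eq_some_iff.1 hm
  simp only [positions, sign, Set.mem_Icc, List.length_map]
  omega

/-- The extractor `⟦L⟧` of a marker language: `⟦L⟧(w) = {⟦W⟧ | W ∈ L, sign(W) = w}`. -/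
def ofLanguage {α : Type u} {Γ : Type v} (L : Language (Marker α Γ)) : Extractor α Γ where
  table w := {t | ∃ W ∈ L, sign W = w ∧ markerTuple W = t}
  isTuple := by
    rintro w t ⟨W, -, rfl, rfl⟩
    exact isTupleFor_markerTuple W

/-- The regular `(α, Γ)`-extractors: those represented by a regular marker language. -/
def regularExtractors (α : Type u) (Γ : Type v) : Set (Extractor α Γ) :=
  {E | ∃ L : Language (Marker α Γ), L.IsRegular ∧ E = ofLanguage L}

/-! ### Monadic second order logic over strings -/

/-- Formulas of monadic second order logic over the signature `(<, (P_a)_{a ∈ A})` of `A`-strings,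
with free set variables indexed by `V`. In `MSOFormula A V k l` there are moreover `k` position
variables (indexed by `Fin k`) and `l` set variables (indexed by `Fin l`) in scope, to be bound by
the quantifiers `exPos` and `exSet`, whose newly bound variable has index `0`. Disjunction and
universal quantifiers are expressed through negation as usual. -/
inductive MSOFormula (A : Type u) (V : Type v) : ℕ → ℕ → Type (max u v)
  /-- `x_i < x_j` -/
  | less {k l : ℕ} (i j : Fin k) : MSOFormula A V k l
  /-- `x_i = x_j` -/
  | equal {k l : ℕ} (i j : Fin k) : MSOFormula A V k l
  /-- `P_a(x_i)` -/
  | letter {k l : ℕ} (a : A) (i : Fin k) : MSOFormula A V k l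
  /-- `x_i ∈ X` for a set variable `X` from `V` -/
  | memFree {k l : ℕ} (i : Fin k) (X : V) : MSOFormula A V k l
  /-- `x_i ∈ X` for a set variable `X` bound by a quantifier -/
  | memBound {k l : ℕ} (i : Fin k) (X : Fin l) : MSOFormula A V k l
  | neg {k l : ℕ} (φ : MSOFormula A V k l) : MSOFormula A V k l
  | conj {k l : ℕ} (φ ψ : MSOFormula A V k l) : MSOFormula A V k l
  | exPos {k l : ℕ} (φ : MSOFormula A V (k + 1) l) : MSOFormula A V k l
  | exSet {k l : ℕ} (φ : MSOFormula A V k (l + 1)) : MSOFormula A V k l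

/-- Satisfaction of a formula in the string `w`, seen as the structure on `{1, …, |w|}` with its
linear order and the unary predicates `P_a = {i | w[i] = a}`. Here `S` interprets the set variables
from `V`, and `p` and `P` interpret the position and set variables in scope of quantifiers. -/
def MSOFormula.Sat {A : Type u} {V : Type v} (w : List A) (S : V → Set ℕ) :
    {k l : ℕ} → MSOFormula A V k l → (Fin k → ℕ) → (Fin l → Set ℕ) → Prop
  | _, _, .less i j, p, _ => p i < p j
  | _, _, .equal i j, p, _ => p i = p j
  | _, _, .letter a i, p, _ => HasLetter w (p i) a
  | _, _, .memFree i X, p, _ => p i ∈ S X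
  | _, _, .memBound i X, p, P => p i ∈ P X
  | _, _, .neg φ, p, P => ¬ φ.Sat w S p P
  | _, _, .conj φ ψ, p, P => φ.Sat w S p P ∧ ψ.Sat w S p P
  | _, _, .exPos φ, p, P => ∃ i ∈ positions w, φ.Sat w S (Fin.cons (α := fun _ => ℕ) i p) P
  | _, _, .exSet φ, p, P =>
      ∃ T ⊆ positions w, φ.Sat w S p (Fin.cons (α := fun _ => Set ℕ) T P)

/-- The extractor `⟦φ⟧` of a formula over `α`-strings whose free variables are set variables
`X_γ`, one for each attribute `γ ∈ Γ`:
`⟦φ⟧(w)` is the set of all `Γ`-tuples `t` for `w` with `w ⊨ φ(t)`. -/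
def ofFormula {α : Type u} {Γ : Type v} (φ : MSOFormula α Γ 0 0) : Extractor α Γ where
  table w := {t | IsTupleFor w t ∧ φ.Sat w t Fin.elim0 Fin.elim0}
  isTuple := fun _ _ h => h.1

/-- The `(α, Γ)`-extractors described by monadic second order formulas. -/
def msoExtractors (α : Type u) (Γ : Type v) : Set (Extractor α Γ) :=
  {E | ∃ φ : MSOFormula α Γ 0 0, E = ofFormula φ}

/-! ### Algebraic expressions over atomic extractors -/

/-- The atomic extractor `E_{X,b}`: its table is empty on every string other than `b`, and its
table on `b` consists of the single tuple `t` with `t(x) = {1}` for `x ∈ X` and `t(y) = ∅` for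
`y ∉ X`. -/
def atomicExtractor {α : Type u} {Γ : Type v} (X : Set Γ) (b : α) : Extractor α Γ where
  table w := {t | w = [b] ∧ (∀ x ∈ X, t x = {1}) ∧ ∀ y ∉ X, t y = ∅}
  isTuple := by
    rintro w t ⟨rfl, h1, h2⟩ x
    by_cases hx : x ∈ X
    · rw [h1 x hx]
      simp [positions]
    · rw [h2 x hx]
      exact Set.empty_subset _

/-- The set of all atomic `(α, Γ)`-extractors. -/
def atomicExtractors (α : Type u) (Γ : Type v) : Set (Extractor α Γ) :=
  {E | ∃ (X : Set Γ) (b : α), E = atomicExtractor X b}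

/-- Expressions with the operations union, concatenation and Kleene star over atoms from `𝒜`.
As for regular expressions, the constant `∅` (the empty union) is an expression. -/
inductive Expr {α : Type u} {Γ : Type v} (𝒜 : Set (Extractor α Γ)) : Type (max u v)
  | empty : Expr 𝒜
  | atom (E : Extractor α Γ) (hE : E ∈ 𝒜) : Expr 𝒜
  | union (e₁ e₂ : Expr 𝒜) : Expr 𝒜
  | concat (e₁ e₂ : Expr 𝒜) : Expr 𝒜
  | star (e : Expr 𝒜) : Expr 𝒜

/-- The extractor described by an expression. -/
def Expr.eval {α : Type u} {Γ : Type v} {𝒜 : Set (Extractor α Γ)} : Expr 𝒜 → Extractor α Γ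
  | .empty => Extractor.nowhere α Γ
  | .atom E _ => E
  | .union e₁ e₂ => Extractor.union e₁.eval e₂.eval
  | .concat e₁ e₂ => Extractor.concat e₁.eval e₂.eval
  | .star e => Extractor.star e.eval

/-- The set of all extractors described by expressions with union, concatenation and Kleene star
over atoms from `𝒜`. -/
def exprClosure {α : Type u} {Γ : Type v} (𝒜 : Set (Extractor α Γ)) : Set (Extractor α Γ) :=
  {E | ∃ e : Expr 𝒜, E = e.eval}

end InfoExtraction

/-! A marker string carries exactly the data of a string together with a tuple for it: `encode` and
the pair `sign`, `markerTuple` are mutually inverse. Extractors are therefore languages over the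
marker alphabet, and both equalities become classical theorems about regular languages.

Under this correspondence atomic extractors are one-letter languages, and `ofLanguage` carries
union, concatenation and star of languages to those of extractors. Expressions over atoms are thus
regular expressions over markers, and the algebraic side is Kleene's theorem. Closure of regular
languages under product and star comes from Myhill-Nerode, by counting left quotients; the converse,
`Language.IsRegular.isRational`, solves a right-linear system with Arden's lemma.

The logical side is Büchi's theorem. From formulas to automata (`exists_isRegular_describes`), every
variable in scope becomes an additional attribute, a position being a singleton set; connectives are
Boolean operations and a quantifier erases a track. From automata to formulas
(`exists_coversRun_iff`), one set variable per state guesses the run, whose correctness is a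
first-order condition on neighbouring positions. -/

namespace Language

open scoped Computability

variable {A : Type u} {B : Type v} {L L₁ L₂ : Language A}

/-! ### Closure properties of regular languages -/

theorem isRegular_accepts {σ : Type v} [Finite σ] (M : DFA A σ) : M.accepts.IsRegular :=
  isRegular_iff.2 ⟨σ, Fintype.ofFinite σ, M, rfl⟩

theorem isRegular_acceptsNFA {σ : Type v} [Finite σ] (M : NFA A σ) : M.accepts.IsRegular :=
  M.toDFA_correct ▸ isRegular_accepts M.toDFA

theorem isRegular_zero : (0 : Language A).IsRegular := by
  have : (0 : Language A) = (⟨fun s _ => s, (), ∅⟩ : DFA A Unit).accepts := by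
    ext x
    simp [DFA.mem_accepts]
  exact this ▸ isRegular_accepts _

theorem isRegular_singleton (a : A) : ({[a]} : Language A).IsRegular := by
  let M : NFA A Bool := ⟨fun s b => {t | s = false ∧ t = true ∧ b = a}, {false}, {true}⟩
  have : ({[a]} : Language A) = M.accepts := by
    ext x
    change x = [a] ↔ _
    simp only [NFA.accepts_iff_exists_path, M]
    constructor
    · rintro rfl
      exact ⟨false, rfl, true, rfl, ⟨.cons _ _ _ _ _ ⟨rfl, rfl, rfl⟩ (.nil _)⟩⟩
    · rintro ⟨_, rfl, _, rfl, ⟨p⟩⟩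
      cases p with
      | cons _ _ _ _ _ h p =>
        obtain ⟨-, rfl, rfl⟩ := h
        cases p with
        | nil => rfl
        | cons _ _ _ _ _ h p => exact absurd h.1 (by simp)
  exact this ▸ isRegular_acceptsNFA _

/-- The image of a regular language under a letter-to-letter map is regular. -/
theorem IsRegular.map (hL : L.IsRegular) (f : A → B) : (Language.map f L).IsRegular := by
  obtain ⟨σ, _, M, rfl⟩ := hL
  let N : NFA B σ := ⟨fun s b => {t | ∃ a, f a = b ∧ M.step s a = t}, {M.start}, M.accept⟩
  -- The automaton `N` guesses a preimage of each letter, so its subset construction collects the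
  -- states that `M` reaches on preimages of `y`.
  have key : ∀ y : List B, N.eval y = {s | ∃ x, x.map f = y ∧ M.eval x = s} := by
    intro y
    induction y using List.reverseRecOn with
    | nil =>
      ext s
      simp [N, eq_comm]
    | append_singleton y b ih =>
      ext s
      rw [NFA.eval_append_singleton, ih, NFA.mem_stepSet]
      constructor
      · rintro ⟨_, ⟨x, rfl, rfl⟩, a, rfl, rfl⟩
        exact ⟨x ++ [a], by simp, by simp⟩
      · rintro ⟨x, hx, rfl⟩
        obtain ⟨x', x'', rfl, rfl, h⟩ := List.map_eq_append_iff.1 hx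
        obtain ⟨a, rfl, rfl⟩ := List.map_eq_singleton_iff.1 h
        exact ⟨_, ⟨x', rfl, rfl⟩, a, rfl, by simp⟩
  have : Language.map f M.accepts = N.accepts := by
    ext y
    change (∃ x, x ∈ M.accepts ∧ x.map f = y) ↔ ∃ s ∈ M.accept, s ∈ N.eval y
    simp only [key, DFA.mem_accepts]
    constructor
    · rintro ⟨x, hx, rfl⟩
      exact ⟨_, hx, x, rfl, rfl⟩
    · rintro ⟨_, h, x, rfl, rfl⟩
      exact ⟨x, h, rfl⟩
  exact this ▸ isRegular_acceptsNFA N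

/-- Myhill-Nerode: the quotient of `L₁ * L₂` by `x` is the product of the quotient of `L₁` by `x`
with `L₂`, together with the quotients of `L₂` by those suffixes of `x` whose complementary prefix
lies in `L₁`. It is determined by one quotient of `L₁` and a set of quotients of `L₂`, which leaves
finitely many possibilities. -/
theorem IsRegular.mul (h₁ : L₁.IsRegular) (h₂ : L₂.IsRegular) : (L₁ * L₂).IsRegular := by
  apply IsRegular.of_finite_range_leftQuotient
  refine Set.Finite.subset ((h₁.finite_range_leftQuotient.prod
    h₂.finite_range_leftQuotient.finite_subsets).image
    (fun q => {z | z ∈ q.1 * L₂ ∨ ∃ K ∈ q.2, z ∈ K})) ?_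
  rintro _ ⟨x, rfl⟩
  refine ⟨(L₁.leftQuotient x, {K | ∃ x' ∈ L₁, ∃ y, x = x' ++ y ∧ K = L₂.leftQuotient y}),
    ⟨⟨x, rfl⟩, ?_⟩, ?_⟩
  · rintro _ ⟨x', -, y, -, rfl⟩
    exact ⟨y, rfl⟩
  · apply Language.ext
    intro z
    change (z ∈ L₁.leftQuotient x * L₂ ∨ _) ↔ x ++ z ∈ L₁ * L₂
    simp only [Language.mem_mul, mem_leftQuotient]
    constructor
    · rintro (⟨a, ha, b, hb, rfl⟩ | ⟨_, ⟨x', hx', y, rfl, rfl⟩, h⟩)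
      · exact ⟨x ++ a, ha, b, hb, by simp⟩
      · exact ⟨x', hx', y ++ z, h, by simp⟩
    · rintro ⟨a, ha, b, hb, h⟩
      obtain ⟨c, rfl, rfl⟩ | ⟨c, rfl, rfl⟩ := List.append_eq_append_iff.1 h
      · exact .inr ⟨_, ⟨a, ha, c, rfl, rfl⟩, hb⟩
      · exact .inl ⟨c, ha, b, hb, rfl⟩

/-- A factorization of a string in `L∗` cuts any nonempty prefix inside one of the factors. -/
theorem append_mem_kstar_iff {x z : List A} (hx : x ≠ []) :
    x ++ z ∈ L∗ ↔ ∃ x' ∈ L∗, ∃ y, x = x' ++ y ∧ z ∈ L.leftQuotient y * L∗ := by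
  constructor
  · intro h
    obtain ⟨l, hl, hL⟩ := Language.mem_kstar.1 h
    clear h
    induction l generalizing x with
    | nil => simp_all
    | cons u l ih =>
      rw [List.flatten_cons] at hl
      have hu := hL u (by simp)
      have hl' : ∀ y ∈ l, y ∈ L := fun y hy => hL y (by simp [hy])
      obtain ⟨c, rfl, rfl⟩ | ⟨c, rfl, hc⟩ := List.append_eq_append_iff.1 hl
      · exact ⟨[], Language.nil_mem_kstar L, x, rfl,
          Language.mem_mul.2 ⟨c, hu, _, Language.join_mem_kstar hl', rfl⟩⟩
      -- If the prefix ends exactly where `u` ends, the induction hypothesis does not apply to the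
      -- empty rest; `u` is then itself the factor being cut, with nothing left of it.
      · by_cases hc0 : c = []
        · subst hc0
          refine ⟨[], Language.nil_mem_kstar L, u, by simp,
            Language.mem_mul.2 ⟨[], by simpa using hu, z, ?_, rfl⟩⟩
          rw [List.nil_append] at hc
          exact hc ▸ Language.join_mem_kstar hl'
        · obtain ⟨x', hx', y, rfl, h⟩ := ih hc0 hc.symm hl'
          refine ⟨u ++ x', ?_, y, by simp, h⟩
          obtain ⟨l', rfl, h'⟩ := Language.mem_kstar.1 hx'
          exact Language.mem_kstar.2 ⟨u :: l', by simp, by simpa using ⟨hu, h'⟩⟩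
  · rintro ⟨x', hx', y, rfl, h⟩
    obtain ⟨a, ha, b, hb, rfl⟩ := Language.mem_mul.1 h
    obtain ⟨l₁, rfl, h₁⟩ := Language.mem_kstar.1 hx'
    obtain ⟨l₂, rfl, h₂⟩ := Language.mem_kstar.1 hb
    refine Language.mem_kstar.2 ⟨l₁ ++ (y ++ a) :: l₂, by simp, ?_⟩
    simp only [List.mem_append, List.mem_cons]
    rintro v (hv | rfl | hv)
    exacts [h₁ v hv, ha, h₂ v hv]

/-- As for products: by `append_mem_kstar_iff` the quotient by a nonempty string is determined by a
set of quotients of `L`. The quotient by the empty string is `L∗` itself and is inserted separately.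
-/
theorem IsRegular.kstar (h : L.IsRegular) : (L∗).IsRegular := by
  apply IsRegular.of_finite_range_leftQuotient
  refine Set.Finite.subset (Set.Finite.insert (L∗) (h.finite_range_leftQuotient.finite_subsets.image
    (fun q => {z | ∃ K ∈ q, z ∈ K * L∗}))) ?_
  rintro _ ⟨x, rfl⟩
  by_cases hx : x = []
  · subst hx
    exact .inl rfl
  · refine .inr ⟨{K | ∃ x' ∈ L∗, ∃ y, x = x' ++ y ∧ K = L.leftQuotient y}, ?_, ?_⟩
    · rintro _ ⟨x', -, y, -, rfl⟩
      exact ⟨y, rfl⟩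
    · apply Language.ext
      intro z
      rw [mem_leftQuotient, append_mem_kstar_iff hx]
      constructor
      · rintro ⟨_, ⟨x', hx', y, rfl, rfl⟩, h⟩
        exact ⟨x', hx', y, rfl, h⟩
      · rintro ⟨x', hx', y, rfl, h⟩
        exact ⟨_, ⟨x', hx', y, rfl, rfl⟩, h⟩

/-! ### Kleene's theorem: from automata to regular expressions -/

theorem mem_finset_sum {ι : Type*} (s : Finset ι) (f : ι → Language A) (x : List A) :
    x ∈ ∑ i ∈ s, f i ↔ ∃ i ∈ s, x ∈ f i := by
  classical
  induction s using Finset.induction_on with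
  | empty => simp
  | insert a s ha ih =>
    rw [Finset.sum_insert ha, Language.mem_add, ih]
    simp

/-- The languages that are described by regular expressions. -/
def IsRational (L : Language A) : Prop := ∃ r : RegularExpression A, r.matches' = L

theorem isRational_zero : (0 : Language A).IsRational := ⟨0, rfl⟩

theorem isRational_one : (1 : Language A).IsRational := ⟨1, rfl⟩

theorem isRational_singleton (a : A) : ({[a]} : Language A).IsRational := ⟨.char a, rfl⟩

theorem IsRational.add : L₁.IsRational → L₂.IsRational → (L₁ + L₂).IsRational := by
  rintro ⟨r, rfl⟩ ⟨s, rfl⟩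
  exact ⟨r + s, rfl⟩

theorem IsRational.mul : L₁.IsRational → L₂.IsRational → (L₁ * L₂).IsRational := by
  rintro ⟨r, rfl⟩ ⟨s, rfl⟩
  exact ⟨r * s, rfl⟩

theorem IsRational.kstar : L.IsRational → (L∗).IsRational := by
  rintro ⟨r, rfl⟩
  exact ⟨r.star, rfl⟩

theorem isRational_sum {ι : Type*} (s : Finset ι) {f : ι → Language A}
    (hf : ∀ i ∈ s, (f i).IsRational) : (∑ i ∈ s, f i).IsRational :=
  Finset.sum_induction f _ (fun _ _ => .add) isRational_zero hf

/-- The solution of a finite right-linear system of equations with rational coefficients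
that do not contain the empty string is rational. -/
theorem isRational_of_linear_system {ι : Type*} (s : Finset ι) (l n : ι → Language A)
    (m : ι → ι → Language A) (hm : ∀ i j, (m i j).IsRational) (hm0 : ∀ i j, [] ∉ m i j)
    (hn : ∀ i, (n i).IsRational) (h : ∀ i ∈ s, l i = ∑ j ∈ s, m i j * l j + n i) :
    ∀ i ∈ s, (l i).IsRational := by
  classical
  induction s using Finset.induction_on generalizing m n with
  | empty => simp
  | insert k s hk ih =>
    -- Arden's lemma solves the equation of `k` for `l k`; substituting the solution into the other
    -- equations eliminates this unknown.
    have hlk : l k = (m k k)∗ * (∑ j ∈ s, m k j * l j + n k) := by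
      apply (Language.self_eq_mul_add_iff (hm0 k k)).1
      conv_lhs => rw [h k (by simp), Finset.sum_insert hk, add_assoc]
    have hs : ∀ i ∈ s, (l i).IsRational := by
      refine ih (fun i => n i + m i k * (m k k)∗ * n k)
        (fun i j => m i j + m i k * (m k k)∗ * m k j)
        (fun i j => (hm i j).add (((hm i k).mul (hm k k).kstar).mul (hm k j))) ?_
        (fun i => (hn i).add (((hm i k).mul (hm k k).kstar).mul (hn k))) ?_
      · intro i j hij
        rw [Language.mem_add, Language.mem_mul] at hij
        obtain hij | ⟨a, ha, b, hb, hab⟩ := hij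
        · exact hm0 i j hij
        · obtain ⟨rfl, rfl⟩ := List.append_eq_nil_iff.1 hab
          exact hm0 k j hb
      · intro i hi
        rw [h i (by simp [hi]), Finset.sum_insert hk, hlk]
        simp only [add_mul, mul_add, Finset.sum_add_distrib, Finset.mul_sum, mul_assoc]
        abel
    intro i hi
    obtain rfl | hi := Finset.mem_insert.1 hi
    · rw [hlk]
      exact (hm _ _).kstar.mul ((isRational_sum s fun j hj => (hm _ j).mul (hs j hj)).add (hn _))
    · exact hs i hi

/-- A regular language over a finite alphabet is described by a regular expression. -/
theorem IsRegular.isRational [Finite A] (hL : L.IsRegular) : L.IsRational := by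
  classical
  obtain ⟨σ, _, M, rfl⟩ := hL
  have := Fintype.ofFinite A
  -- The unknowns are the languages accepted from each state; the coefficient from `s` to `t` is the
  -- set of letters leading from `s` to `t`, and the constant term records whether `s` accepts.
  refine isRational_of_linear_system Finset.univ M.acceptsFrom
    (fun s => if s ∈ M.accept then 1 else 0)
    (fun s t => ∑ a with M.step s a = t, {[a]}) ?_ ?_ ?_ ?_ M.start (Finset.mem_univ _)
  · exact fun s t => isRational_sum _ fun a _ => isRational_singleton a
  · intro s t h
    obtain ⟨a, -, h⟩ := (mem_finset_sum _ _ _).1 h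
    cases (show [] = [a] from h)
  · intro s
    split_ifs
    exacts [isRational_one, isRational_zero]
  · intro s _
    ext x
    rw [Language.mem_add]
    have h1 : x ∈ (if s ∈ M.accept then (1 : Language A) else 0) ↔ x = [] ∧ s ∈ M.accept := by
      split_ifs with h <;> simp [h]
    rw [h1]
    simp only [mem_finset_sum, Language.mem_mul]
    cases x with
    | nil =>
      simp only [DFA.mem_acceptsFrom, DFA.evalFrom_nil, true_and]
      refine ⟨.inr, ?_⟩
      rintro (⟨t, -, u, ⟨a, -, hu⟩, v, -, h⟩ | h)
      · obtain rfl : u = [a] := hu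
        simp at h
      · exact h
    | cons a x =>
      constructor
      · intro h
        exact .inl ⟨M.step s a, by simp, [a], ⟨a, by simp, rfl⟩, x, h, rfl⟩
      · rintro (⟨t, -, u, ⟨b, hb, hu⟩, v, hv, h⟩ | ⟨h, -⟩)
        · obtain rfl : u = [b] := hu
          obtain ⟨rfl, rfl⟩ : b = a ∧ v = x := by simpa using h
          obtain rfl : M.step s b = t := by simpa using hb
          exact hv
        · cases h

end Language

namespace InfoExtraction

open scoped Computability

variable {α : Type u} {Γ : Type v}

/-! ### Marker strings as encodings of a string with a tuple -/

theorem hasLetter_append {A : Type u} {w₁ w₂ : List A} {i : ℕ} {a : A} :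
    HasLetter (w₁ ++ w₂) i a ↔
      HasLetter w₁ i a ∨ ∃ j, HasLetter w₂ j a ∧ j + w₁.length = i := by
  unfold HasLetter
  rw [List.getElem?_append]
  constructor
  · rintro ⟨h, h'⟩
    split_ifs at h' with hi
    · exact .inl ⟨h, h'⟩
    · refine .inr ⟨i - w₁.length, ⟨by omega, ?_⟩, by omega⟩
      rw [← h']
      congr 1
      omega
  · rintro (⟨h, h'⟩ | ⟨j, ⟨h, h'⟩, rfl⟩)
    · refine ⟨h, ?_⟩
      rw [if_pos (List.getElem?_eq_some_iff.1 h').1, h']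
    · refine ⟨by omega, ?_⟩
      rw [if_neg (by omega), ← h']
      congr 1
      omega

theorem hasLetter_singleton {A : Type u} {a b : A} {i : ℕ} :
    HasLetter [b] i a ↔ i = 1 ∧ a = b := by
  unfold HasLetter
  constructor
  · rintro ⟨h, h'⟩
    obtain ⟨hlt, h'⟩ := List.getElem?_eq_some_iff.1 h'
    simp only [List.length_singleton] at hlt
    obtain rfl : i = 1 := by omega
    exact ⟨rfl, by simpa using h'.symm⟩
  · rintro ⟨rfl, rfl⟩
    simp

theorem not_hasLetter_nil {A : Type u} {a : A} {i : ℕ} : ¬ HasLetter [] i a := by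
  simp [HasLetter]

theorem HasLetter.mem_positions {A : Type u} {w : List A} {i : ℕ} {a : A}
    (h : HasLetter w i a) : i ∈ positions w := by
  have := (List.getElem?_eq_some_iff.1 h.2).1
  have := h.1
  exact ⟨h.1, by omega⟩

theorem HasLetter.unique {A : Type u} {w : List A} {i : ℕ} {a b : A}
    (ha : HasLetter w i a) (hb : HasLetter w i b) : a = b :=
  Option.some.inj (ha.2.symm.trans hb.2)

theorem exists_hasLetter {A : Type u} {w : List A} {i : ℕ} (h : i ∈ positions w) :
    ∃ a, HasLetter w i a := by
  have h1 := h.1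
  have h2 := h.2
  exact ⟨w[i - 1], h.1, List.getElem?_eq_getElem (by omega)⟩

theorem hasLetter_map {A : Type u} {B : Type v} {w : List A} {f : A → B} {i : ℕ} {b : B} :
    HasLetter (w.map f) i b ↔ ∃ a, HasLetter w i a ∧ f a = b := by
  simp [HasLetter, and_assoc]

theorem positions_sign (W : List (Marker α Γ)) : positions (sign W) = positions W := by
  simp [positions, sign]

theorem mem_markerTuple_iff {W : List (Marker α Γ)} {i : ℕ} {m : Marker α Γ}
    (h : HasLetter W i m) (x : Γ) : i ∈ markerTuple W x ↔ x ∈ m.1 :=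
  ⟨fun ⟨_, h', hx⟩ => h'.unique h ▸ hx, fun hx => ⟨m, h, hx⟩⟩

theorem hasLetter_sign_iff {W : List (Marker α Γ)} {i : ℕ} {m : Marker α Γ}
    (h : HasLetter W i m) (a : α) : HasLetter (sign W) i a ↔ m.2 = a := by
  rw [sign, hasLetter_map]
  exact ⟨fun ⟨m', h', ha⟩ => h'.unique h ▸ ha, fun ha => ⟨m, h, ha⟩⟩

theorem markerTuple_append (W₁ W₂ : List (Marker α Γ)) :
    markerTuple (W₁ ++ W₂) = tupleConcat (sign W₁).length (markerTuple W₁) (markerTuple W₂) := by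
  funext x
  ext i
  simp only [markerTuple, tupleConcat, hasLetter_append, Set.mem_ofPred_eq, Set.mem_union,
    Set.mem_image, sign, List.length_map]
  constructor
  · rintro ⟨m, h | ⟨j, h, rfl⟩, hx⟩
    · exact .inl ⟨m, h, hx⟩
    · exact .inr ⟨j, ⟨m, h, hx⟩, rfl⟩
  · rintro (⟨m, h, hx⟩ | ⟨j, ⟨m, h, hx⟩, rfl⟩)
    · exact ⟨m, .inl h, hx⟩
    · exact ⟨m, .inr ⟨j, h, rfl⟩, hx⟩

theorem markerTuple_nil : markerTuple ([] : List (Marker α Γ)) = fun _ => ∅ := by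
  funext x
  simp [markerTuple, not_hasLetter_nil]

/-- The marker string with sign `w` that represents the tuple `t`. -/
def encode (w : List α) (t : Γ → Set ℕ) : List (Marker α Γ) :=
  -- `mapIdx` counts from 0, positions from 1.
  w.mapIdx fun i a => ({x | i + 1 ∈ t x}, a)

theorem hasLetter_encode {w : List α} {t : Γ → Set ℕ} {i : ℕ} {m : Marker α Γ} :
    HasLetter (encode w t) i m ↔ HasLetter w i m.2 ∧ ∀ x, x ∈ m.1 ↔ i ∈ t x := by
  unfold HasLetter encode
  rw [List.getElem?_mapIdx, and_assoc]
  refine and_congr_right fun hi => ?_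
  rw [Option.map_eq_some_iff, Nat.sub_add_cancel hi]
  constructor
  · rintro ⟨a, h, rfl⟩
    exact ⟨h, fun _ => Iff.rfl⟩
  · rintro ⟨h, h'⟩
    exact ⟨m.2, h, Prod.ext (Set.ext fun x => (h' x).symm) rfl⟩

theorem sign_encode (w : List α) (t : Γ → Set ℕ) : sign (encode w t) = w := by
  exact List.ext_getElem (by simp [sign, encode]) fun i _ _ => by simp [sign, encode]

theorem markerTuple_encode {w : List α} {t : Γ → Set ℕ} (h : IsTupleFor w t) :
    markerTuple (encode w t) = t := by
  funext x
  ext i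
  simp only [markerTuple, hasLetter_encode, Set.mem_ofPred_eq]
  constructor
  · rintro ⟨m, ⟨-, h'⟩, hx⟩
    exact (h' x).1 hx
  · intro hi
    obtain ⟨a, ha⟩ := exists_hasLetter (h x hi)
    exact ⟨({x | i ∈ t x}, a), ⟨ha, fun _ => Iff.rfl⟩, hi⟩

theorem encode_sign_markerTuple (W : List (Marker α Γ)) :
    encode (sign W) (markerTuple W) = W := by
  apply List.ext_getElem?
  intro i
  by_cases hi : i < W.length
  · have h : HasLetter W (i + 1) W[i] := ⟨by omega, by simp⟩
    have h' : HasLetter (encode (sign W) (markerTuple W)) (i + 1) W[i] :=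
      hasLetter_encode.2 ⟨(hasLetter_sign_iff h _).2 rfl, fun x => (mem_markerTuple_iff h x).symm⟩
    exact h'.2.trans h.2.symm
  · have h : (encode (sign W) (markerTuple W)).length = W.length := by simp [encode, sign]
    rw [List.getElem?_eq_none (not_lt.1 hi), List.getElem?_eq_none (h ▸ not_lt.1 hi)]

theorem eq_of_sign_eq_of_markerTuple_eq {W W' : List (Marker α Γ)} (h : sign W = sign W')
    (h' : markerTuple W = markerTuple W') : W = W' := by
  rw [← encode_sign_markerTuple W, h, h', encode_sign_markerTuple]

/-! ### Operations on marker languages and on extractors -/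

theorem ofLanguage_zero : ofLanguage (0 : Language (Marker α Γ)) = .nowhere α Γ := by
  ext w t
  simp [ofLanguage, Extractor.nowhere]

theorem ofLanguage_one : ofLanguage (1 : Language (Marker α Γ)) = .unit α Γ := by
  ext w t
  simp only [ofLanguage, Extractor.unit, Set.mem_ofPred_eq, Language.mem_one]
  constructor
  · rintro ⟨_, rfl, rfl, rfl⟩
    exact ⟨rfl, markerTuple_nil⟩
  · rintro ⟨rfl, rfl⟩
    exact ⟨[], rfl, rfl, markerTuple_nil⟩

theorem ofLanguage_singleton (X : Set Γ) (b : α) :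
    ofLanguage ({[(X, b)]} : Language (Marker α Γ)) = atomicExtractor X b := by
  have key : ∀ t : Γ → Set ℕ, markerTuple [((X, b) : Marker α Γ)] = t ↔
      (∀ x ∈ X, t x = {1}) ∧ ∀ y ∉ X, t y = ∅ := by
    have h1 : ∀ x ∈ X, markerTuple [((X, b) : Marker α Γ)] x = {1} := by
      intro x hx
      ext i
      simp [markerTuple, hasLetter_singleton, hx]
    have h2 : ∀ x ∉ X, markerTuple [((X, b) : Marker α Γ)] x = ∅ := by
      intro x hx
      ext i
      simp [markerTuple, hasLetter_singleton, hx]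
    intro t
    constructor
    · rintro rfl
      exact ⟨h1, h2⟩
    · rintro ⟨h3, h4⟩
      funext x
      by_cases hx : x ∈ X
      · rw [h1 x hx, h3 x hx]
      · rw [h2 x hx, h4 x hx]
  ext w t
  simp only [ofLanguage, atomicExtractor, Set.mem_ofPred_eq]
  constructor
  · rintro ⟨W, hW, rfl, h⟩
    obtain rfl : W = [(X, b)] := hW
    exact ⟨rfl, (key t).1 h⟩
  · rintro ⟨rfl, h⟩
    exact ⟨[(X, b)], rfl, rfl, (key t).2 h⟩

theorem ofLanguage_add (L₁ L₂ : Language (Marker α Γ)) :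
    ofLanguage (L₁ + L₂) = .union (ofLanguage L₁) (ofLanguage L₂) := by
  ext w t
  simp only [ofLanguage, Extractor.union, Set.mem_ofPred_eq, Language.mem_add, Set.mem_union,
    or_and_right, exists_or]

theorem ofLanguage_mul (L₁ L₂ : Language (Marker α Γ)) :
    ofLanguage (L₁ * L₂) = .concat (ofLanguage L₁) (ofLanguage L₂) := by
  ext w t
  simp only [ofLanguage, Extractor.concat, Set.mem_ofPred_eq, Language.mem_mul]
  constructor
  · rintro ⟨_, ⟨W₁, h₁, W₂, h₂, rfl⟩, rfl, rfl⟩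
    exact ⟨sign W₁, sign W₂, by simp [sign], _, ⟨W₁, h₁, rfl, rfl⟩, _, ⟨W₂, h₂, rfl, rfl⟩,
      markerTuple_append W₁ W₂⟩
  · rintro ⟨_, _, rfl, _, ⟨W₁, h₁, rfl, rfl⟩, _, ⟨W₂, h₂, rfl, rfl⟩, rfl⟩
    exact ⟨W₁ ++ W₂, ⟨W₁, h₁, W₂, h₂, rfl⟩, by simp [sign], markerTuple_append W₁ W₂⟩

theorem ofLanguage_pow (L : Language (Marker α Γ)) (k : ℕ) :
    ofLanguage (L ^ k) = (ofLanguage L).power k := by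
  induction k with
  | zero => rw [pow_zero, ofLanguage_one, Extractor.power]
  | succ k ih => rw [pow_succ, ofLanguage_mul, ih, Extractor.power]

theorem ofLanguage_kstar (L : Language (Marker α Γ)) :
    ofLanguage (L∗) = (ofLanguage L).star := by
  ext w t
  simp only [Extractor.star, ← ofLanguage_pow, Language.kstar_eq_iSup_pow]
  simp only [ofLanguage, Language.mem_iSup, Set.mem_iUnion, Set.mem_ofPred_eq]
  constructor
  · rintro ⟨W, ⟨k, h⟩, h'⟩
    exact ⟨k, W, h, h'⟩
  · rintro ⟨k, W, h, h'⟩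
    exact ⟨W, ⟨k, h⟩, h'⟩

theorem exprClosure_subset_regularExtractors :
    exprClosure (atomicExtractors α Γ) ⊆ regularExtractors α Γ := by
  rintro _ ⟨e, rfl⟩
  induction e with
  | empty => exact ⟨0, Language.isRegular_zero, ofLanguage_zero.symm⟩
  | atom E hE =>
    obtain ⟨X, b, rfl⟩ := hE
    exact ⟨_, Language.isRegular_singleton (X, b), (ofLanguage_singleton X b).symm⟩
  | union e₁ e₂ ih₁ ih₂ =>
    obtain ⟨L₁, h₁, h₁'⟩ := ih₁
    obtain ⟨L₂, h₂, h₂'⟩ := ih₂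
    exact ⟨L₁ + L₂, h₁.add h₂, by rw [Expr.eval, h₁', h₂', ofLanguage_add]⟩
  | concat e₁ e₂ ih₁ ih₂ =>
    obtain ⟨L₁, h₁, h₁'⟩ := ih₁
    obtain ⟨L₂, h₂, h₂'⟩ := ih₂
    exact ⟨L₁ * L₂, h₁.mul h₂, by rw [Expr.eval, h₁', h₂', ofLanguage_mul]⟩
  | star e ih =>
    obtain ⟨L, h, h'⟩ := ih
    exact ⟨L∗, h.kstar, by rw [Expr.eval, h', ofLanguage_kstar]⟩

theorem regularExtractors_subset_exprClosure [Finite α] [Finite Γ] :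
    regularExtractors α Γ ⊆ exprClosure (atomicExtractors α Γ) := by
  rintro _ ⟨L, hL, rfl⟩
  obtain ⟨r, rfl⟩ := hL.isRational
  clear hL
  induction r with
  | zero => exact ⟨.empty, ofLanguage_zero⟩
  | epsilon =>
    -- Expressions have no constant for the empty string; it is the star of `∅`.
    refine ⟨.star .empty, ?_⟩
    rw [Expr.eval, Expr.eval, ← ofLanguage_zero, ← ofLanguage_kstar, kstar_zero]
    rfl
  | char m => exact ⟨.atom _ ⟨m.1, m.2, rfl⟩, ofLanguage_singleton m.1 m.2⟩
  | plus r₁ r₂ ih₁ ih₂ =>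
    obtain ⟨e₁, h₁⟩ := ih₁
    obtain ⟨e₂, h₂⟩ := ih₂
    exact ⟨.union e₁ e₂, by rw [Expr.eval, ← h₁, ← h₂, ← ofLanguage_add]; rfl⟩
  | comp r₁ r₂ ih₁ ih₂ =>
    obtain ⟨e₁, h₁⟩ := ih₁
    obtain ⟨e₂, h₂⟩ := ih₂
    exact ⟨.concat e₁ e₂, by rw [Expr.eval, ← h₁, ← h₂, ← ofLanguage_mul]; rfl⟩
  | star r ih =>
    obtain ⟨e, h⟩ := ih
    exact ⟨.star e, by rw [Expr.eval, ← h, ← ofLanguage_kstar]; rfl⟩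

/-! ### From formulas to regular languages -/

theorem hasLetter_append_singleton {A : Type u} {w : List A} {i : ℕ} {a b : A} :
    HasLetter (w ++ [b]) i a ↔ HasLetter w i a ∨ (i = w.length + 1 ∧ a = b) := by
  simp only [hasLetter_append, hasLetter_singleton]
  constructor
  · rintro (h | ⟨j, ⟨rfl, rfl⟩, rfl⟩)
    exacts [.inl h, .inr ⟨by omega, rfl⟩]
  · rintro (h | ⟨rfl, rfl⟩)
    exacts [.inl h, .inr ⟨1, ⟨rfl, rfl⟩, by omega⟩]

/-- The strings with a letter from `C`. -/
def withLetter {A : Type u} (C : Set A) : Language A :=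
  {w | ∃ i, ∃ a ∈ C, HasLetter w i a}

/-- The strings with a letter from `C` and a letter from `D` at a later position. -/
def withPair {A : Type u} (C D : Set A) : Language A :=
  {w | ∃ i j, i < j ∧ (∃ a ∈ C, HasLetter w i a) ∧ ∃ b ∈ D, HasLetter w j b}

theorem mem_withLetter {A : Type u} {C : Set A} {w : List A} :
    w ∈ withLetter C ↔ ∃ i, ∃ a ∈ C, HasLetter w i a := Iff.rfl

theorem mem_withPair {A : Type u} {C D : Set A} {w : List A} :
    w ∈ withPair C D ↔
      ∃ i j, i < j ∧ (∃ a ∈ C, HasLetter w i a) ∧ ∃ b ∈ D, HasLetter w j b := Iff.rfl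

theorem nil_notMem_withLetter {A : Type u} (C : Set A) : [] ∉ withLetter C := by
  simp [mem_withLetter, not_hasLetter_nil]

theorem nil_notMem_withPair {A : Type u} (C D : Set A) : [] ∉ withPair C D := by
  simp [mem_withPair, not_hasLetter_nil]

theorem append_singleton_mem_withLetter {A : Type u} {C : Set A} {w : List A} {a : A} :
    w ++ [a] ∈ withLetter C ↔ w ∈ withLetter C ∨ a ∈ C := by
  simp only [mem_withLetter, hasLetter_append_singleton]
  constructor
  · rintro ⟨i, b, hb, h | ⟨-, rfl⟩⟩
    exacts [.inl ⟨i, b, hb, h⟩, .inr hb]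
  · rintro (⟨i, b, hb, h⟩ | h)
    exacts [⟨i, b, hb, .inl h⟩, ⟨_, a, h, .inr ⟨rfl, rfl⟩⟩]

/-- Together with `append_singleton_mem_withLetter` this is the transition function of a
deterministic automaton whose states are the truth values of the two memberships. -/
theorem append_singleton_mem_withPair {A : Type u} {C D : Set A} {w : List A} {a : A} :
    w ++ [a] ∈ withPair C D ↔ w ∈ withPair C D ∨ (w ∈ withLetter C ∧ a ∈ D) := by
  simp only [mem_withPair, mem_withLetter, hasLetter_append_singleton]
  constructor
  · rintro ⟨i, j, hij, ⟨b, hb, h⟩, c, hc, h' | ⟨rfl, rfl⟩⟩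
    · obtain h | ⟨rfl, -⟩ := h
      · exact .inl ⟨i, j, hij, ⟨b, hb, h⟩, c, hc, h'⟩
      · have := h'.mem_positions.2
        omega
    · obtain h | ⟨rfl, -⟩ := h
      · exact .inr ⟨⟨i, b, hb, h⟩, hc⟩
      · omega
  · rintro (⟨i, j, hij, ⟨b, hb, h⟩, c, hc, h'⟩ | ⟨⟨i, b, hb, h⟩, ha⟩)
    · exact ⟨i, j, hij, ⟨b, hb, .inl h⟩, c, hc, .inl h'⟩
    · exact ⟨i, _, Nat.lt_succ_of_le h.mem_positions.2, ⟨b, hb, .inl h⟩, a, ha, .inr ⟨rfl, rfl⟩⟩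

theorem isRegular_withLetter {A : Type u} (C : Set A) : (withLetter C).IsRegular := by
  let M : DFA A Prop := ⟨fun s a => s ∨ a ∈ C, False, {s | s}⟩
  have h : withLetter C = M.accepts := by
    ext w
    change w ∈ withLetter C ↔ M.eval w
    induction w using List.reverseRecOn with
    | nil => simpa [M] using nil_notMem_withLetter C
    | append_singleton w a ih => rw [append_singleton_mem_withLetter, ih, DFA.eval_append_singleton]
  exact h ▸ Language.isRegular_accepts M

theorem isRegular_withPair {A : Type u} (C D : Set A) : (withPair C D).IsRegular := by
  let M : DFA A (Prop × Prop) :=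
    ⟨fun s a => (s.1 ∨ a ∈ C, s.2 ∨ s.1 ∧ a ∈ D), (False, False), {s | s.2}⟩
  have h : ∀ w, M.eval w = (w ∈ withLetter C, w ∈ withPair C D) := by
    intro w
    induction w using List.reverseRecOn with
    | nil => simp [M, nil_notMem_withLetter, nil_notMem_withPair]
    | append_singleton w a ih =>
      rw [append_singleton_mem_withLetter, append_singleton_mem_withPair,
        DFA.eval_append_singleton, ih]
  have h' : withPair C D = M.accepts := by
    ext w
    change w ∈ withPair C D ↔ (M.eval w).2
    rw [h]
  exact h' ▸ Language.isRegular_accepts M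

/-- Renaming of attributes along `g`: the marker set `X` becomes `g ⁻¹' X`. -/
def Marker.pull {V : Type*} (g : V → Γ) : Marker α Γ → Marker α V := Prod.map (g ⁻¹' ·) id

theorem sign_map_pull {V : Type*} (g : V → Γ) (W : List (Marker α Γ)) :
    sign (W.map (Marker.pull g)) = sign W := by
  simp [sign, Marker.pull]

theorem markerTuple_map_pull {V : Type*} (g : V → Γ) (W : List (Marker α Γ)) :
    markerTuple (W.map (Marker.pull g)) = markerTuple W ∘ g := by
  funext x
  ext i
  simp only [markerTuple, hasLetter_map, Function.comp, Set.mem_ofPred_eq]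
  constructor
  · rintro ⟨_, ⟨m, h, rfl⟩, hx⟩
    exact ⟨m, h, hx⟩
  · rintro ⟨m, h, hx⟩
    exact ⟨_, ⟨m, h, rfl⟩, hx⟩

/-- The attributes for a formula with `k` position and `l` set variables in scope. -/
abbrev Tracks (Γ : Type v) (k l : ℕ) : Type v := Γ ⊕ (Fin k ⊕ Fin l)

/-- The language `L` describes the formula `φ`, where a position variable is represented by the
singleton of its value. -/
def Describes {k l : ℕ} (L : Language (Marker α (Tracks Γ k l))) (φ : MSOFormula α Γ k l) : Prop :=
  ∀ (U : List (Marker α (Tracks Γ k l))) (p : Fin k → ℕ),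
    (∀ i, markerTuple U (.inr (.inl i)) = {p i}) →
    (U ∈ L ↔ φ.Sat (sign U) (markerTuple U ∘ .inl) p (markerTuple U ∘ .inr ∘ .inr))

/-- The strings in which the attribute `x` holds a singleton. -/
def singletonTrack (α : Type u) (x : Γ) : Language (Marker α Γ) :=
  withLetter {m | x ∈ m.1} ⊓ (withPair {m | x ∈ m.1} {m | x ∈ m.1})ᶜ

theorem isRegular_singletonTrack (x : Γ) : (singletonTrack α x).IsRegular :=
  (isRegular_withLetter _).inf (isRegular_withPair _ _).compl

theorem mem_singletonTrack {x : Γ} {U : List (Marker α Γ)} :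
    U ∈ singletonTrack α x ↔ ∃ i, markerTuple U x = {i} := by
  have h1 : ∀ i, (∃ m ∈ {m : Marker α Γ | x ∈ m.1}, HasLetter U i m) ↔ i ∈ markerTuple U x :=
    fun i => ⟨fun ⟨m, h, h'⟩ => ⟨m, h', h⟩, fun ⟨m, h', h⟩ => ⟨m, h, h'⟩⟩
  change U ∈ withLetter _ ∧ ¬ U ∈ withPair _ _ ↔ _
  simp only [mem_withLetter, mem_withPair, h1]
  constructor
  · rintro ⟨⟨i, hi⟩, h⟩
    refine ⟨i, Set.eq_singleton_iff_unique_mem.2 ⟨hi, fun j hj => ?_⟩⟩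
    by_contra hne
    obtain hlt | hlt := lt_or_gt_of_ne hne
    exacts [h ⟨j, i, hlt, hj, hi⟩, h ⟨i, j, hlt, hi, hj⟩]
  · rintro ⟨i, hi⟩
    rw [hi]
    refine ⟨⟨i, rfl⟩, ?_⟩
    rintro ⟨j, j', h, rfl, rfl⟩
    exact lt_irrefl _ h

/-- Only the letter at `p` carries the attribute `x`, so demanding `x` pins the search for a letter
to that position. -/
theorem mem_withLetter_track_iff {x : Γ} {U : List (Marker α Γ)} {p : ℕ}
    (hp : markerTuple U x = {p}) (Q : Set (Marker α Γ)) :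
    U ∈ withLetter {m | x ∈ m.1 ∧ m ∈ Q} ↔ ∃ m ∈ Q, HasLetter U p m := by
  rw [mem_withLetter]
  constructor
  · rintro ⟨i, m, ⟨hx, hm⟩, h⟩
    have hi : i ∈ markerTuple U x := ⟨m, h, hx⟩
    rw [hp] at hi
    obtain rfl : i = p := hi
    exact ⟨m, hm, h⟩
  · rintro ⟨m, hm, h⟩
    exact ⟨p, m, ⟨(mem_markerTuple_iff h x).1 (hp ▸ rfl), hm⟩, h⟩

/-- A singleton position value together with membership of that position in another attribute. -/
theorem mem_withLetter_inter_iff {x y : Γ} {U : List (Marker α Γ)} {p : ℕ}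
    (hp : markerTuple U x = {p}) :
    U ∈ withLetter {m | x ∈ m.1 ∧ y ∈ m.1} ↔ p ∈ markerTuple U y :=
  (mem_withLetter_track_iff hp {m | y ∈ m.1}).trans
    ⟨fun ⟨m, h, h'⟩ => ⟨m, h', h⟩, fun ⟨m, h', h⟩ => ⟨m, h, h'⟩⟩

/-- Existential quantification is projection: the track of the bound variable is erased. Since
`Describes` says nothing about strings whose position tracks are not singletons, these have to be
discarded before erasing. -/
theorem Describes.exPos {k l : ℕ} {L : Language (Marker α (Tracks Γ (k + 1) l))}
    {φ : MSOFormula α Γ (k + 1) l} (h : Describes L φ) :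
    Describes (Language.map (Marker.pull (Sum.map id (Sum.map Fin.succ id)))
      (L ⊓ singletonTrack α (.inr (.inl 0)))) φ.exPos := by
  intro U p hp
  change (∃ V, V ∈ L ⊓ singletonTrack α _ ∧ V.map _ = U) ↔ _
  constructor
  · rintro ⟨V, ⟨hV, hV'⟩, rfl⟩
    obtain ⟨i, hi⟩ := mem_singletonTrack.1 hV'
    rw [markerTuple_map_pull] at hp ⊢
    rw [sign_map_pull]
    refine ⟨i, ?_, (h V _ ?_).1 hV⟩
    · exact isTupleFor_markerTuple V (.inr (.inl 0)) (by rw [hi]; rfl)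
    · intro j
      cases j using Fin.cases with
      | zero => exact hi
      | succ j => exact hp j
  · rintro ⟨i, hi, hs⟩
    -- The new track holds the witness `i`; the others are those of `U`, with position indices
    -- shifted by one.
    let t : Tracks Γ (k + 1) l → Set ℕ := Sum.elim (markerTuple U ∘ .inl)
      (Sum.elim (Fin.cons (α := fun _ => Set ℕ) {i} (markerTuple U ∘ .inr ∘ .inl))
        (markerTuple U ∘ .inr ∘ .inr))
    have ht : IsTupleFor (sign U) t := by
      intro x
      obtain x | x | x := x
      · exact isTupleFor_markerTuple U _
      · cases x using Fin.cases with
        | zero => exact Set.singleton_subset_iff.2 hi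
        | succ x => exact isTupleFor_markerTuple U _
      · exact isTupleFor_markerTuple U _
    have hm := markerTuple_encode ht
    refine ⟨encode (sign U) t, ⟨(h _ (Fin.cons (α := fun _ => ℕ) i p) ?_).2 ?_,
      mem_singletonTrack.2 ⟨i, by rw [hm]; rfl⟩⟩, ?_⟩
    · intro j
      rw [hm]
      cases j using Fin.cases with
      | zero => rfl
      | succ j => exact hp j
    · rw [hm, sign_encode]
      exact hs
    · apply eq_of_sign_eq_of_markerTuple_eq
      · rw [sign_map_pull, sign_encode]
      · rw [markerTuple_map_pull, hm]
        funext x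
        obtain x | x | x := x <;> rfl

/-- Projection again; a set track may hold any set of positions, so nothing has to be discarded. -/
theorem Describes.exSet {k l : ℕ} {L : Language (Marker α (Tracks Γ k (l + 1)))}
    {φ : MSOFormula α Γ k (l + 1)} (h : Describes L φ) :
    Describes (Language.map (Marker.pull (Sum.map id (Sum.map id Fin.succ))) L) φ.exSet := by
  intro U p hp
  change (∃ V, V ∈ L ∧ V.map _ = U) ↔ _
  constructor
  · rintro ⟨V, hV, rfl⟩
    rw [markerTuple_map_pull] at hp ⊢
    rw [sign_map_pull]
    refine ⟨markerTuple V (.inr (.inr 0)), isTupleFor_markerTuple V _, ?_⟩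
    have hP : Fin.cons (α := fun _ => Set ℕ) (markerTuple V (.inr (.inr 0)))
        (fun i => markerTuple V (.inr (.inr i.succ))) = markerTuple V ∘ .inr ∘ .inr := by
      funext x
      cases x using Fin.cases <;> rfl
    exact (congrArg _ hP).mpr ((h V p hp).1 hV)
  · rintro ⟨T, hT, hs⟩
    let t : Tracks Γ k (l + 1) → Set ℕ := Sum.elim (markerTuple U ∘ .inl)
      (Sum.elim (markerTuple U ∘ .inr ∘ .inl)
        (Fin.cons (α := fun _ => Set ℕ) T (markerTuple U ∘ .inr ∘ .inr)))
    have ht : IsTupleFor (sign U) t := by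
      intro x
      obtain x | x | x := x
      · exact isTupleFor_markerTuple U _
      · exact isTupleFor_markerTuple U _
      · cases x using Fin.cases with
        | zero => exact hT
        | succ x => exact isTupleFor_markerTuple U _
    have hm := markerTuple_encode ht
    refine ⟨encode (sign U) t, (h _ p ?_).2 ?_, ?_⟩
    · intro j
      rw [hm]
      exact hp j
    · rw [hm, sign_encode]
      exact hs
    · apply eq_of_sign_eq_of_markerTuple_eq
      · rw [sign_map_pull, sign_encode]
      · rw [markerTuple_map_pull, hm]
        funext x
        obtain x | x | x := x <;> rfl

theorem exists_isRegular_describes {k l : ℕ} (φ : MSOFormula α Γ k l) :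
    ∃ L : Language (Marker α (Tracks Γ k l)), L.IsRegular ∧ Describes L φ := by
  induction φ with
  | less i j =>
    refine ⟨withPair {m | .inr (.inl i) ∈ m.1} {m | .inr (.inl j) ∈ m.1},
      isRegular_withPair _ _, fun U p hp => ?_⟩
    have h1 : ∀ i n, (∃ m ∈ {m : Marker α (Tracks Γ _ _) | .inr (.inl i) ∈ m.1},
        HasLetter U n m) ↔ n = p i := fun i n =>
      (⟨fun ⟨m, h, h'⟩ => ⟨m, h', h⟩, fun ⟨m, h', h⟩ => ⟨m, h, h'⟩⟩ :
        _ ↔ n ∈ markerTuple U (.inr (.inl i))).trans (by rw [hp, Set.mem_singleton_iff])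
    rw [mem_withPair]
    simp only [h1]
    exact ⟨by rintro ⟨_, _, h, rfl, rfl⟩; exact h, fun h => ⟨_, _, h, rfl, rfl⟩⟩
  | equal i j =>
    refine ⟨_, isRegular_withLetter {m | .inr (.inl i) ∈ m.1 ∧ .inr (.inl j) ∈ m.1},
      fun U p hp => ?_⟩
    rw [mem_withLetter_inter_iff (hp i), hp j]
    rfl
  | letter a i =>
    refine ⟨_, isRegular_withLetter {m | .inr (.inl i) ∈ m.1 ∧ m ∈ {m | m.2 = a}},
      fun U p hp => ?_⟩
    rw [mem_withLetter_track_iff (hp i)]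
    exact (⟨fun ⟨m, h, h'⟩ => ⟨m, h', h⟩, fun ⟨m, h', h⟩ => ⟨m, h, h'⟩⟩ : _ ↔ _).trans
      hasLetter_map.symm
  | memFree i X =>
    exact ⟨_, isRegular_withLetter {m | .inr (.inl i) ∈ m.1 ∧ .inl X ∈ m.1},
      fun U p hp => mem_withLetter_inter_iff (hp i)⟩
  | memBound i X =>
    exact ⟨_, isRegular_withLetter {m | .inr (.inl i) ∈ m.1 ∧ .inr (.inr X) ∈ m.1},
      fun U p hp => mem_withLetter_inter_iff (hp i)⟩
  | neg φ ih =>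
    obtain ⟨L, hL, h⟩ := ih
    -- Plain complement suffices: strings with an invalid position track may land in it, but
    -- `Describes` ignores them.
    exact ⟨Lᶜ, hL.compl, fun U p hp => not_congr (h U p hp)⟩
  | conj φ ψ ih₁ ih₂ =>
    obtain ⟨L₁, hL₁, h₁⟩ := ih₁
    obtain ⟨L₂, hL₂, h₂⟩ := ih₂
    exact ⟨L₁ ⊓ L₂, hL₁.inf hL₂, fun U p hp => and_congr (h₁ U p hp) (h₂ U p hp)⟩
  | exPos φ ih =>
    obtain ⟨L, hL, h⟩ := ih
    exact ⟨_, (hL.inf (isRegular_singletonTrack _)).map _, h.exPos⟩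
  | exSet φ ih =>
    obtain ⟨L, hL, h⟩ := ih
    exact ⟨_, hL.map _, h.exSet⟩

theorem msoExtractors_subset_regularExtractors :
    msoExtractors α Γ ⊆ regularExtractors α Γ := by
  rintro _ ⟨φ, rfl⟩
  obtain ⟨_, ⟨σ, _, M, rfl⟩, h⟩ := exists_isRegular_describes φ
  -- A sentence in this sense has no tracks besides `Γ`; `g` identifies the two attribute alphabets.
  let g : Tracks Γ 0 0 → Γ := Sum.elim id (Sum.elim Fin.elim0 Fin.elim0)
  refine ⟨(M.comap (Marker.pull g)).accepts, Language.isRegular_accepts _, ?_⟩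
  have key : ∀ W : List (Marker α Γ), W ∈ (M.comap (Marker.pull g)).accepts ↔
      φ.Sat (sign W) (markerTuple W) Fin.elim0 Fin.elim0 := by
    intro W
    have hW := h (W.map (Marker.pull g)) Fin.elim0 (fun i => i.elim0)
    rw [sign_map_pull, markerTuple_map_pull] at hW
    rw [DFA.accepts_comap]
    refine hW.trans (iff_of_eq ?_)
    congr 1
    exact Subsingleton.elim _ _
  ext w t
  constructor
  · rintro ⟨ht, hs⟩
    refine ⟨encode w t, (key _).2 ?_, sign_encode w t, markerTuple_encode ht⟩
    rwa [sign_encode, markerTuple_encode ht]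
  · rintro ⟨W, hW, rfl, rfl⟩
    exact ⟨isTupleFor_markerTuple W, (key W).1 hW⟩

/-! ### From regular languages to formulas -/

/-- The relations between strings and values of the variables that are defined by formulas. -/
def Definable {k l : ℕ}
    (R : List α → (Γ → Set ℕ) → (Fin k → ℕ) → (Fin l → Set ℕ) → Prop) : Prop :=
  ∃ φ : MSOFormula α Γ k l, ∀ w S p P, φ.Sat w S p P ↔ R w S p P

namespace Definable

variable {k l : ℕ} {R R₁ R₂ : List α → (Γ → Set ℕ) → (Fin k → ℕ) → (Fin l → Set ℕ) → Prop}

theorem not : Definable R → Definable fun w S p P => ¬ R w S p P :=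
  fun ⟨φ, h⟩ => ⟨φ.neg, fun w S p P => not_congr (h w S p P)⟩

theorem and : Definable R₁ → Definable R₂ → Definable fun w S p P => R₁ w S p P ∧ R₂ w S p P :=
  fun ⟨φ, h⟩ ⟨ψ, h'⟩ => ⟨φ.conj ψ, fun w S p P => and_congr (h w S p P) (h' w S p P)⟩

theorem congr (h : Definable R₁) (h' : ∀ w S p P, R₁ w S p P ↔ R₂ w S p P) : Definable R₂ :=
  let ⟨φ, hφ⟩ := h
  ⟨φ, fun w S p P => (hφ w S p P).trans (h' w S p P)⟩

theorem imp (h₁ : Definable R₁) (h₂ : Definable R₂) :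
    Definable fun w S p P => R₁ w S p P → R₂ w S p P :=
  (h₁.and h₂.not).not.congr fun _ _ _ _ => by rw [not_and, not_not]

theorem iff (h₁ : Definable R₁) (h₂ : Definable R₂) :
    Definable fun w S p P => (R₁ w S p P ↔ R₂ w S p P) :=
  ((h₁.imp h₂).and (h₂.imp h₁)).congr fun _ _ _ _ => iff_iff_implies_and_implies.symm

theorem exPos {R : List α → (Γ → Set ℕ) → (Fin (k + 1) → ℕ) → (Fin l → Set ℕ) → Prop} :
    Definable R → Definable fun w S p P =>
      ∃ i ∈ positions w, R w S (Fin.cons (α := fun _ => ℕ) i p) P :=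
  fun ⟨φ, h⟩ => ⟨φ.exPos, fun w S _ P => exists_congr fun _ => and_congr_right fun _ => h w S _ P⟩

theorem allPos {R : List α → (Γ → Set ℕ) → (Fin (k + 1) → ℕ) → (Fin l → Set ℕ) → Prop}
    (h : Definable R) : Definable fun w S p P =>
      ∀ i ∈ positions w, R w S (Fin.cons (α := fun _ => ℕ) i p) P :=
  h.not.exPos.not.congr fun _ _ _ _ => by push Not; rfl

theorem of_true : Definable (α := α) (Γ := Γ) fun (_ : List α) _ (_ : Fin k → ℕ)
    (_ : Fin l → Set ℕ) => True :=
  -- Truth is expressed as: no position is smaller than itself.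
  ⟨(MSOFormula.exPos (.less 0 0)).neg, fun _ _ _ _ =>
    iff_true_intro fun ⟨_, _, h⟩ => lt_irrefl _ h⟩

theorem const (c : Prop) : Definable (α := α) (Γ := Γ) fun (_ : List α) _ (_ : Fin k → ℕ)
    (_ : Fin l → Set ℕ) => c := by
  by_cases hc : c
  · exact of_true.congr fun _ _ _ _ => (iff_true_intro hc).symm
  · exact of_true.not.congr fun _ _ _ _ => by simp [hc]

theorem forall_finite {ι : Type*} [Finite ι]
    {R : ι → List α → (Γ → Set ℕ) → (Fin k → ℕ) → (Fin l → Set ℕ) → Prop}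
    (h : ∀ i, Definable (R i)) : Definable fun w S p P => ∀ i, R i w S p P := by
  classical
  have := Fintype.ofFinite ι
  have key : ∀ s : Finset ι, Definable fun w S p P => ∀ i ∈ s, R i w S p P := by
    intro s
    induction s using Finset.induction_on with
    | empty => exact of_true.congr fun _ _ _ _ => by simp
    | insert a s _ ih =>
      exact ((h a).and ih).congr fun _ _ _ _ => by simp
  exact (key Finset.univ).congr fun _ _ _ _ => by simp

/-- Quantification over finitely many set variables. -/
theorem exSets {n : ℕ} {R : List α → (Γ → Set ℕ) → (Fin k → ℕ) → (Fin n → Set ℕ) → Prop}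
    (h : Definable R) : Definable fun w S p (_ : Fin 0 → Set ℕ) =>
      ∃ P, (∀ i, P i ⊆ positions w) ∧ R w S p P := by
  induction n with
  | zero =>
    refine h.congr fun w S p P => ?_
    rw [Subsingleton.elim P Fin.elim0]
    exact ⟨fun h => ⟨_, fun i => i.elim0, h⟩, fun ⟨P, _, h⟩ => Subsingleton.elim P Fin.elim0 ▸ h⟩
  | succ n ih =>
    -- The set variable of index 0 is bound innermost by `exSet`; the induction hypothesis binds the
    -- other `n`.
    obtain ⟨φ, hφ⟩ := h
    refine (ih (R := fun w S p P => ∃ T ⊆ positions w, R w S p (Fin.cons (α := fun _ => Set ℕ) T P))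
      ⟨φ.exSet, fun w S p P => exists_congr fun _ => and_congr_right fun _ => hφ w S p _⟩).congr
      fun w S p _ => ?_
    constructor
    · rintro ⟨P, hP, T, hT, h⟩
      refine ⟨_, fun i => ?_, h⟩
      cases i using Fin.cases with
      | zero => exact hT
      | succ i => exact hP i
    · rintro ⟨P, hP, h⟩
      refine ⟨Fin.tail P, fun i => hP _, P 0, hP 0, ?_⟩
      rwa [Fin.cons_self_tail]

theorem less (i j : Fin k) : Definable (α := α) (Γ := Γ) (l := l) fun _ _ p _ => p i < p j :=
  ⟨.less i j, fun _ _ _ _ => Iff.rfl⟩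

theorem memBound (i : Fin k) (X : Fin l) : Definable (α := α) (Γ := Γ) fun _ _ p P => p i ∈ P X :=
  ⟨.memBound i X, fun _ _ _ _ => Iff.rfl⟩

end Definable

/-- `Reads w S x m`: the marker string with sign `w` and tuple `S` has the letter `m` at `x`. -/
def Reads (w : List α) (S : Γ → Set ℕ) (x : ℕ) (m : Marker α Γ) : Prop :=
  HasLetter w x m.2 ∧ ∀ γ, x ∈ S γ ↔ γ ∈ m.1

theorem Definable.reads [Finite Γ] {k l : ℕ} (i : Fin k) (m : Marker α Γ) :
    Definable (l := l) fun w S p _ => Reads w S (p i) m :=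
  .and ⟨.letter m.2 i, fun _ _ _ _ => Iff.rfl⟩
    (.forall_finite fun γ => .iff ⟨.memFree i γ, fun _ _ _ _ => Iff.rfl⟩ (.const _))

theorem reads_iff (W : List (Marker α Γ)) (x : ℕ) (m : Marker α Γ) :
    Reads (sign W) (markerTuple W) x m ↔ HasLetter W x m := by
  constructor
  · rintro ⟨h, h'⟩
    obtain ⟨m', hm', h2⟩ := hasLetter_map.1 h
    have : m' = m := Prod.ext (Set.ext fun γ =>
      (mem_markerTuple_iff hm' γ).symm.trans (h' γ)) h2
    exact this ▸ hm'
  · intro h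
    exact ⟨(hasLetter_sign_iff h _).2 rfl, mem_markerTuple_iff h⟩

section Run

variable {n : ℕ} (M : DFA (Marker α Γ) (Fin n))

/-- The sets `P q` contain the positions after whose letter `M` is in state `q`, and `M` accepts
at the last position. -/
def CoversRun (w : List α) (S : Γ → Set ℕ) (P : Fin n → Set ℕ) : Prop :=
  (∀ x ∈ positions w, (¬ ∃ y ∈ positions w, y < x) →
    ∀ m, Reads w S x m → x ∈ P (M.step M.start m)) ∧
  (∀ x ∈ positions w, ∀ y ∈ positions w, x < y → (¬ ∃ z ∈ positions w, x < z ∧ z < y) →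
    ∀ m q, Reads w S y m → x ∈ P q → y ∈ P (M.step q m)) ∧
  (∀ x ∈ positions w, (¬ ∃ y ∈ positions w, x < y) → ∀ q, q ∉ M.accept → x ∉ P q)

/-- Quantifiers over letters and states become finite conjunctions, as the marker alphabet is
finite. The most recently bound position has index 0, so `x` is `p 0` in its own scope and `p 1`
below the quantifier for `y`. -/
theorem definable_coversRun [Finite α] [Finite Γ] :
    Definable fun w S (_ : Fin 0 → ℕ) P => CoversRun M w S P := by
  have first : Definable (α := α) (Γ := Γ) fun w _ (p : Fin 1 → ℕ) (_ : Fin n → Set ℕ) =>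
      ¬ ∃ y ∈ positions w, y < p 0 :=
    (Definable.exPos (R := fun _ _ p _ => p 0 < p 1) (.less 0 1)).not
  have last : Definable (α := α) (Γ := Γ) fun w _ (p : Fin 1 → ℕ) (_ : Fin n → Set ℕ) =>
      ¬ ∃ y ∈ positions w, p 0 < y :=
    (Definable.exPos (R := fun _ _ p _ => p 1 < p 0) (.less 1 0)).not
  have next : Definable (α := α) (Γ := Γ) fun w _ (p : Fin 2 → ℕ) (_ : Fin n → Set ℕ) =>
      ¬ ∃ z ∈ positions w, p 1 < z ∧ z < p 0 :=
    (Definable.exPos (R := fun _ _ p _ => p 2 < p 0 ∧ p 0 < p 1) (.and (.less 2 0) (.less 0 1))).not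
  refine .and ?_ (.and ?_ ?_)
  · exact Definable.allPos (R := fun w S p P => (¬ ∃ y ∈ positions w, y < p 0) →
      ∀ m, Reads w S (p 0) m → p 0 ∈ P (M.step M.start m))
      (first.imp (.forall_finite fun m => .imp (.reads 0 m) (.memBound 0 _)))
  · exact Definable.allPos (R := fun w S p P => ∀ y ∈ positions w, p 0 < y →
      (¬ ∃ z ∈ positions w, p 0 < z ∧ z < y) →
      ∀ m q, Reads w S y m → p 0 ∈ P q → y ∈ P (M.step q m))
      (Definable.allPos (R := fun w S p P => p 1 < p 0 →
        (¬ ∃ z ∈ positions w, p 1 < z ∧ z < p 0) →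
        ∀ m q, Reads w S (p 0) m → p 1 ∈ P q → p 0 ∈ P (M.step q m))
        (.imp (.less 1 0) (next.imp (.forall_finite fun m => .forall_finite fun q =>
          .imp (.reads 0 m) (.imp (.memBound 1 q) (.memBound 0 _))))))
  · exact Definable.allPos (R := fun w S p P => (¬ ∃ y ∈ positions w, p 0 < y) →
      ∀ q, q ∉ M.accept → p 0 ∉ P q)
      (last.imp (.forall_finite fun q => .imp (.const _) (.not (.memBound 0 q))))

/-- The sets need not be disjoint. By determinism, the first two clauses force every position into
the set of its true state, by induction along the string; the third then rules out a rejecting last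
state. Conversely, the exact run is a witness. On the empty string all clauses hold vacuously, so it
is excluded. -/
theorem exists_coversRun_iff {W : List (Marker α Γ)} (hW : W ≠ []) :
    (∃ P : Fin n → Set ℕ, (∀ q, P q ⊆ positions (sign W)) ∧
      CoversRun M (sign W) (markerTuple W) P) ↔ W ∈ M.accepts := by
  have hlen : 1 ≤ W.length := List.length_pos_iff.2 hW
  -- The state at position `x + 1` is the one after the prefix of length `x + 1`; for `x = 0` the
  -- preceding state is the start state.
  have hstep : ∀ x m, HasLetter W (x + 1) m → M.eval (W.take (x + 1)) =
      M.step (M.eval (W.take x)) m := by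
    intro x m h
    rw [List.take_add_one, ← DFA.eval_append_singleton]
    congr 2
    simp [show W[x]? = some m from h.2]
  simp only [CoversRun, positions_sign, reads_iff]
  simp only [positions, Set.mem_Icc]
  constructor
  · rintro ⟨P, -, h1, h2, h3⟩
    have key : ∀ x, 1 ≤ x → x ≤ W.length → x ∈ P (M.eval (W.take x)) := by
      intro x hx
      induction x, hx using Nat.le_induction with
      | base =>
        intro hx
        obtain ⟨m, hm⟩ := exists_hasLetter (w := W) (i := 1) ⟨le_rfl, hx⟩
        rw [hstep 0 m hm]
        exact h1 1 ⟨le_rfl, hx⟩ (by rintro ⟨y, hy, hlt⟩; omega) m hm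
      | succ x hx ih =>
        intro hx'
        obtain ⟨m, hm⟩ := exists_hasLetter (w := W) (i := x + 1) ⟨by omega, hx'⟩
        rw [hstep x m hm]
        exact h2 x ⟨hx, by omega⟩ (x + 1) ⟨by omega, hx'⟩ (by omega)
          (by rintro ⟨z, hz, hlt⟩; omega) m _ hm (ih (by omega))
    by_contra hna
    refine h3 W.length ⟨hlen, le_rfl⟩ (by rintro ⟨y, hy, hlt⟩; omega) (M.eval W) hna ?_
    simpa using key W.length hlen le_rfl
  · intro h
    refine ⟨fun q => {x | (1 ≤ x ∧ x ≤ W.length) ∧ M.eval (W.take x) = q},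
      fun q x hx => hx.1, ?_, ?_, ?_⟩
    · intro x hx hmin m hm
      obtain rfl : x = 1 := by
        by_contra hne
        exact hmin ⟨1, ⟨le_rfl, hlen⟩, by omega⟩
      exact ⟨hx, hstep 0 m hm⟩
    · rintro x hx y hy hxy hsucc m _ hm ⟨-, rfl⟩
      obtain rfl : y = x + 1 := by
        by_contra hne
        exact hsucc ⟨x + 1, ⟨by omega, by omega⟩, by omega, by omega⟩
      exact ⟨hy, hstep x m hm⟩
    · rintro x hx hmax _ hq ⟨-, rfl⟩
      obtain rfl : x = W.length := by
        by_contra hne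
        exact hmax ⟨W.length, ⟨hlen, le_rfl⟩, by omega⟩
      rw [List.take_length] at hq
      exact hq h

end Run

theorem regularExtractors_subset_msoExtractors [Finite α] [Finite Γ] :
    regularExtractors α Γ ⊆ msoExtractors α Γ := by
  rintro _ ⟨_, ⟨σ, _, M', rfl⟩, rfl⟩
  -- Numbering the states lets set variables be indexed by them.
  obtain ⟨n, M, hM⟩ : ∃ (n : ℕ) (M : DFA (Marker α Γ) (Fin n)), M.accepts = M'.accepts :=
    ⟨_, DFA.reindex (Fintype.equivFin σ) M', DFA.accepts_reindex _ _⟩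
  rw [← hM]
  -- The formula tests whether a position exists; on the empty string it takes the constant truth
  -- value of acceptance.
  obtain ⟨φ, hφ⟩ : Definable (α := α) (Γ := Γ) fun w S (_ : Fin 0 → ℕ) (_ : Fin 0 → Set ℕ) =>
      ((∃ i ∈ positions w, True) → ∃ P : Fin n → Set ℕ, (∀ q, P q ⊆ positions w) ∧
        CoversRun M w S P) ∧ (¬ (∃ i ∈ positions w, True) → [] ∈ M.accepts) :=
    have h := Definable.exPos (α := α) (Γ := Γ) (k := 0) (l := 0) .of_true
    (h.imp (definable_coversRun M).exSets).and (h.not.imp (.const _))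
  have key : ∀ W : List (Marker α Γ),
      φ.Sat (sign W) (markerTuple W) Fin.elim0 Fin.elim0 ↔ W ∈ M.accepts := by
    intro W
    rw [hφ]
    by_cases hW : W = []
    · subst hW
      simp [positions, sign]
    · have : ∃ i ∈ positions (sign W), True :=
        ⟨1, by rw [positions_sign]; exact ⟨le_rfl, List.length_pos_iff.2 hW⟩, trivial⟩
      rw [← exists_coversRun_iff M hW]
      exact ⟨fun h => h.1 this, fun h => ⟨fun _ => h, fun h' => absurd this h'⟩⟩
  refine ⟨φ, ?_⟩
  ext w t
  constructor
  · rintro ⟨W, hW, rfl, rfl⟩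
    exact ⟨isTupleFor_markerTuple W, (key W).2 hW⟩
  · rintro ⟨ht, hs⟩
    refine ⟨encode w t, (key _).1 ?_, sign_encode w t, markerTuple_encode ht⟩
    rwa [sign_encode, markerTuple_encode ht]

end InfoExtraction

theorem mainTheorem1 (α : Type u) (Γ : Type v) [Finite α] [Finite Γ] :
    InfoExtraction.regularExtractors α Γ = InfoExtraction.msoExtractors α Γ ∧
    InfoExtraction.msoExtractors α Γ =
      InfoExtraction.exprClosure (InfoExtraction.atomicExtractors α Γ) := by
  have h := Set.Subset.antisymm
    (InfoExtraction.regularExtractors_subset_msoExtractors (α := α) (Γ := Γ))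
    InfoExtraction.msoExtractors_subset_regularExtractors
  exact ⟨h, h ▸ Set.Subset.antisymm InfoExtraction.regularExtractors_subset_exprClosure
    InfoExtraction.exprClosure_subset_regularExtractors⟩
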